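/- Let $n\ge 1$, $L,\varepsilon,T>0$, $\Omega=\mathbb R^{n-1}\times(-L,0)$, $\Gamma_0=\mathbb R^{n-1}\times\{0\}$, $\Gamma_1=\mathbb R^{n-1}\times\{-L\}$, and let $X$ be the closure of $\mathcal D(\overline\Omega)$ for the norm $\|u\|_X=\big(\|u\|_{L^2(\Omega)}^2+\varepsilon\|u\|_{L^2(\partial\Omega)}^2\big)^{1/2}$ (real-valued functions; an element of $X$ consists of a function on $\Omega$ and boundary values on $\partial\Omega$). On $V=H^1(\Omega)$, identified with a subspace of $X$ through $u\mapsto(u,u|_{\partial\Omega})$, let $$a(u,v)=\varepsilon\int_\Omega\nabla u\cdot\nabla v+\int_\Omega \partial_n u\, v+\int_{\Gamma_1}uv ,$$ and let $\mathcal A$ be the associated operator on $X$: $u\in\mathcal D(\mathcal A)$ and $\mathcal Au=w$ if and only if $u\in V$ and $a(u,v)=\langle -w,v\rangle_X$ for all $v\in V$. Let $\mathcal A^*$ be its adjoint in $X$. Consider the system $$(S_0)\quad \begin{cases}u_t+\partial_nu-\varepsilon\Delta u=0 & \text{in }(0,T)\times\Omega,\\ \varepsilon(u_t+\partial_\nu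 u)=0&\text{on }(0,T)\times\Gamma_0,\\ \varepsilon(u_t+\partial_\nu u)+u=0&\text{on }(0,T)\times\Gamma_1,\\ u(0,\cdot)=u_0&\text{in }\Omega,\end{cases}$$ that is, $\dot u=\mathcal Au$, $u(0)=u_0$, and its adjoint system $$(S')\quad \begin{cases}\varphi_t+\partial_n\varphi+\varepsilon\Delta\varphi=0 & \text{in }(0,T)\times\Omega,\\ \varepsilon(\varphi_t-\partial_\nu\varphi)-\varphi=0&\text{on }(0,T)\times\Gamma_0,\\ \varphi_t-\partial_\nu\varphi=0&\text{on }(0,T)\times\Gamma_1,\\ \varphi(T,\cdot)=\varphi_T&\text{in }\Omega,\end{cases}$$ that is, $\dot\varphi+\mathcal A^*\varphi=0$, $\varphi(T)=\varphi_T$. For $u_0\in X$, a weak solution of $(S_0)$ is a function $u\in C([0,T],X)$ with $u(0)=u_0$ and $u(t)=e^{t\mathcal A}u_0$, in the sense that $\int_0^tu(s)\,ds\in\mathcal D(\mathcal A)$ and $u(t)-u_0=\mathcal A\int_0^tu(s)\,ds$ for all $t\in[0,T]$. For $\varphi_T\in X$, a weak solution of $(S')$ is a function $\varphi\in C([0,T],X)$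 with $\varphi(T)=\varphi_T$ and $\varphi(t)=e^{(T-t)\mathcal A^*}\varphi_T$, in the sense that $\int_t^T\varphi(s)\,ds\in\mathcal D(\mathcal A^*)$ and $\varphi(t)-\varphi_T=\mathcal A^*\int_t^T\varphi(s)\,ds$ for all $t\in[0,T]$. Proposition (backward uniqueness). If $u$ is a weak solution of $(S_0)$ with initial value $u_0\in X$ and $u(T)=0$, then $u_0=0$. If $\varphi$ is a weak solution of $(S')$ with final value $\varphi_T\in X$ and $\varphi(0)=0$, then $\varphi_T=0$. -/

import Mathlib

open MeasureTheory Set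

namespace AdvDiff

noncomputable section

/-- The space `ℝⁿ`, with `n = d + 1 ≥ 1`; the last coordinate is `xₙ`. -/
abbrev Pt (d : ℕ) : Type := EuclideanSpace ℝ (Fin (d + 1))

/-- The strip `Ω = ℝⁿ⁻¹ × (-L, 0)`. -/
def Omega (d : ℕ) (L : ℝ) : Set (Pt d) := {x | x (Fin.last d) ∈ Ioo (-L) 0}

/-- The point `(y, c)` of `ℝⁿ⁻¹ × ℝ = ℝⁿ`. -/
def atHeight {d : ℕ} (c : ℝ) (y : EuclideanSpace ℝ (Fin d)) : Pt d :=
  WithLp.toLp 2 (Fin.snoc (α := fun _ => ℝ) (fun i => y i) c)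

theorem continuous_atHeight {d : ℕ} (c : ℝ) : Continuous (atHeight (d := d) c) := by
  unfold atHeight
  refine (PiLp.continuous_toLp 2 _).comp (continuous_pi fun i => ?_)
  refine Fin.lastCases ?_ (fun j => ?_) i
  · simpa using continuous_const
  · simp only [Fin.snoc_castSucc]
    fun_prop

/-- The surface measure of the hyperplane `ℝⁿ⁻¹ × {c}`: the image of the Lebesgue measure of
`ℝⁿ⁻¹` (a unit point mass when `n = 1`). -/
def surf (d : ℕ) (c : ℝ) : Measure (Pt d) := (volume).map (atHeight (d := d) c)

/-- The surface measure of `∂Ω = Γ₀ ∪ Γ₁`, with `Γ₀ = {xₙ = 0}` and `Γ₁ = {xₙ = -L}`. -/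
def bdry (d : ℕ) (L : ℝ) : Measure (Pt d) := surf d 0 + surf d (-L)

/-- The outer unit normal: `eₙ` on `Γ₀` and `-eₙ` on `Γ₁`. -/
def normal {d : ℕ} (x : Pt d) : Pt d :=
  if x (Fin.last d) = 0 then EuclideanSpace.single (Fin.last d) 1
  else -EuclideanSpace.single (Fin.last d) 1

/-- The measure `dx` on `Ω` plus `ε dσ` on `∂Ω`. Its `L²` norm is
`(‖u‖²_{L²(Ω)} + ε ‖u‖²_{L²(∂Ω)})^{1/2}`. -/
def muX (d : ℕ) (L ε : ℝ) : Measure (Pt d) :=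
  volume.restrict (Omega d L) + ENNReal.ofReal ε • bdry d L

/-- Smooth functions with compact support in `ℝⁿ`. Their restrictions to the closed strip make up
`𝒟(Ω̄)`. -/
def IsTest {d : ℕ} (φ : Pt d → ℝ) : Prop :=
  ContDiff ℝ ((⊤ : ℕ∞) : WithTop ℕ∞) φ ∧ HasCompactSupport φ

/-- The Hilbert space `X`: the closure of `𝒟(Ω̄)` for the norm
`(‖u‖²_{L²(Ω)} + ε ‖u‖²_{L²(∂Ω)})^{1/2}`. -/
def X (d : ℕ) (L ε : ℝ) : Submodule ℝ (Lp ℝ 2 (muX d L ε)) :=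
  (Submodule.span ℝ
    {f : Lp ℝ 2 (muX d L ε) | ∃ φ : Pt d → ℝ, IsTest φ ∧ f =ᵐ[muX d L ε] φ}).topologicalClosure

instance (d : ℕ) (L ε : ℝ) : CompleteSpace (X d L ε) :=
  (Submodule.isClosed_topologicalClosure _).completeSpace_coe

/-- The classical partial derivative `∂ᵢφ`. -/
def partialD {d : ℕ} (i : Fin (d + 1)) (φ : Pt d → ℝ) (x : Pt d) : ℝ :=
  fderiv ℝ φ x (EuclideanSpace.single i 1)

/-- `n`-tuples of functions of `L²(Ω)`. -/
abbrev L2Grad (d : ℕ) (L : ℝ) : Type :=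
  Fin (d + 1) → Lp ℝ 2 (volume.restrict (Omega d L) : Measure (Pt d))

/-- `p` is the weak gradient of `f` in `Ω`. -/
def IsWeakGrad {d : ℕ} (L : ℝ) (f : Pt d → ℝ) (p : L2Grad d L) : Prop :=
  ∀ φ : Pt d → ℝ, IsTest φ → tsupport φ ⊆ Omega d L → ∀ i,
    ∫ x in Omega d L, f x * partialD i φ x = -∫ x in Omega d L, p i x * φ x

/-- `g` is the trace on `∂Ω` of the function `f` with weak gradient `p`, by Green's formula. -/
def IsTrace {d : ℕ} (L : ℝ) (f : Pt d → ℝ) (p : L2Grad d L) (g : Pt d → ℝ) : Prop :=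
  ∀ φ : Pt d → ℝ, IsTest φ → ∀ i,
    (∫ x in Omega d L, f x * partialD i φ x) + ∫ x in Omega d L, p i x * φ x
      = ∫ x, g x * φ x * normal x i ∂(bdry d L)

/-- `u`, as an element of `X`, comes from `V = H¹(Ω)`: it has the weak gradient `p ∈ L²(Ω)ⁿ` in
`Ω`, and its values on `∂Ω` are the trace of its restriction to `Ω`. -/
def IsH1 {d : ℕ} {L ε : ℝ} (u : X d L ε) (p : L2Grad d L) : Prop :=
  IsWeakGrad L (u : Lp ℝ 2 (muX d L ε)) p ∧
    IsTrace L (u : Lp ℝ 2 (muX d L ε)) p (u : Lp ℝ 2 (muX d L ε))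

/-- The bilinear form `a(u, v) = ε ∫_Ω ∇u·∇v + ∫_Ω (∂ₙu) v + ∫_{Γ₁} u v`, for `u`, `v` in `V` with
gradients `p`, `q`. -/
def form {d : ℕ} {L ε : ℝ} (u : X d L ε) (p : L2Grad d L) (v : X d L ε) (q : L2Grad d L) : ℝ :=
  ε * (∫ x in Omega d L, ∑ i, p i x * q i x)
    + (∫ x in Omega d L, p (Fin.last d) x * (v : Lp ℝ 2 (muX d L ε)) x)
    + ∫ x, (u : Lp ℝ 2 (muX d L ε)) x * (v : Lp ℝ 2 (muX d L ε)) x ∂(surf d (-L))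

/-- The graph of `𝒜`: `u ∈ D(𝒜)` and `𝒜 u = w`, that is, `u ∈ V` and `a(u, v) = ⟨-w, v⟩_X` for
every `v ∈ V`. -/
def IsA {d : ℕ} {L ε : ℝ} (u w : X d L ε) : Prop :=
  ∃ p, IsH1 u p ∧ ∀ v q, IsH1 v q → form u p v q = inner ℝ (-w) v

/-- The graph of the Hilbert space adjoint `𝒜*`: `u ∈ D(𝒜*)` and `𝒜* u = w`, that is,
`⟨𝒜 v, u⟩_X = ⟨v, w⟩_X` for every `v ∈ D(𝒜)`. -/
def IsAStar {d : ℕ} {L ε : ℝ} (u w : X d L ε) : Prop :=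
  ∀ v z, IsA v z → inner ℝ z u = inner ℝ v w

/-- `u ∈ C([0, T], X)` is the weak (mild) solution `u(t) = e^{t𝒜} u₀` of `u' = 𝒜 u`, `u(0) = u₀`:
for every `t`, `∫₀ᵗ u ∈ D(𝒜)` and `u(t) = u₀ + 𝒜 ∫₀ᵗ u`. -/
def IsWeakSol {d : ℕ} {L ε : ℝ} (T : ℝ) (u₀ : X d L ε) (u : ℝ → X d L ε) : Prop :=
  ContinuousOn u (Icc 0 T) ∧ u 0 = u₀ ∧
    ∀ t ∈ Icc 0 T, IsA (∫ s in (0 : ℝ)..t, u s) (u t - u₀)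

/-- `φ ∈ C([0, T], X)` is the weak (mild) solution `φ(t) = e^{(T-t)𝒜*} φ_T` of `φ' + 𝒜* φ = 0`,
`φ(T) = φ_T`: for every `t`, `∫ₜᵀ φ ∈ D(𝒜*)` and `φ(t) = φ_T + 𝒜* ∫ₜᵀ φ`. -/
def IsAdjointWeakSol {d : ℕ} {L ε : ℝ} (T : ℝ) (φT : X d L ε) (φ : ℝ → X d L ε) : Prop :=
  ContinuousOn φ (Icc 0 T) ∧ φ T = φT ∧
    ∀ t ∈ Icc 0 T, IsAStar (∫ s in t..T, φ s) (φ t - φT)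

end

end AdvDiff

/-! If `u(T) = 0`, the finite Laplace transform `h(z) = ∫₀ᵀ e^{-zt} u(t) dt` solves `(z - 𝒜) h(z) =
u₀` for every complex `z`, even in the spectrum, because the boundary term at `T` drops out. The
form is coercive up to a multiple of the norm of `X`, and its skew part is of first order only.
Testing the equation therefore gives `(2 |Im z| + Re z - κ) ‖h(z)‖ ≤ const` up to a factor
(`resolvent_energy`, `laplace_bound`), so each `⟨ψ, h(z)⟩` is bounded outside a sector of opening `π
/ 2` around the negative real axis. It is also entire of exponential type, so Phragmén-Lindelöf
bounds it inside the sector, Liouville makes it constant, and decay along the positive reals makes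
it zero (`eq_zero_of_sector_bound`). Fourier inversion gives `⟨ψ, u⟩ = 0` on `(0, T)`; then `ψ = u₀`
and `t → 0` give `u₀ = 0`.

The adjoint system reduces to the same statement by reversing time: `𝒜*` is governed by the flipped
form (`formOp_flip_of_adjoint`), which satisfies the same estimates. -/

/-- The graph of the operator associated with the bilinear form `a` on `V`, where `j : V → H`:
`x = j v` and `a(v, φ) = ⟨-w, j φ⟩` for every `φ`. -/
def FormOp {H V : Type*} [NormedAddCommGroup H] [InnerProductSpace ℝ H] [NormedAddCommGroup V]
    [InnerProductSpace ℝ V] (j : V →L[ℝ] H) (a : V →L[ℝ] V →L[ℝ] ℝ) (x w : H) : Prop :=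
  ∃ v, j v = x ∧ ∀ φ, a v φ = inner ℝ (-w) (j φ)

/-! ### Operators of coercive forms: resolvent, adjoint, mild solutions, energy estimate -/

section FormOp

variable {H V : Type*} [NormedAddCommGroup H] [InnerProductSpace ℝ H]
  [NormedAddCommGroup V] [InnerProductSpace ℝ V]
  {j : V →L[ℝ] H} {a : V →L[ℝ] V →L[ℝ] ℝ} {c lam C T : ℝ}

/-- Lax-Milgram: the resolvent of a coercive form. -/
theorem exists_weak_resolvent [CompleteSpace H] [CompleteSpace V] (hc : 0 < c)
    (hcoer : ∀ v, c * ‖v‖ ^ 2 ≤ a v v + lam * ‖j v‖ ^ 2) :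
    ∃ R : H →L[ℝ] V, (∀ f φ, a (R f) φ + lam * inner ℝ (j (R f)) (j φ) = inner ℝ f (j φ)) ∧
      ∀ f v, (∀ φ, a v φ + lam * inner ℝ (j v) (j φ) = inner ℝ f (j φ)) → v = R f := by
  let B : V →L[ℝ] V →L[ℝ] ℝ :=
    a + lam • ((innerSL ℝ).bilinearComp j j : V →L[ℝ] V →L[ℝ] ℝ)
  have hB : ∀ v φ, B v φ = a v φ + lam * inner ℝ (j v) (j φ) := fun v φ => by simp [B]
  have hco : IsCoercive B := ⟨c, hc, fun v => by
    have := hcoer v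
    rw [hB, real_inner_self_eq_norm_sq]; nlinarith⟩
  let S := hco.continuousLinearEquivOfBilin
  refine ⟨(S.symm : V →L[ℝ] V) ∘L (ContinuousLinearMap.adjoint j), fun f φ => ?_, fun f v hv => ?_⟩
  · rw [← hB, ← hco.continuousLinearEquivOfBilin_apply]
    simp [S, ContinuousLinearMap.adjoint_inner_left]
  · have : S v = ContinuousLinearMap.adjoint j f := by
      refine ext_inner_right ℝ fun φ => ?_
      rw [hco.continuousLinearEquivOfBilin_apply, hB, hv, ContinuousLinearMap.adjoint_inner_left]
    simp [← this]

/-- Adding `lam • x` to both sides turns the unbounded relation into a fixed-point equation for the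
bounded operator `j ∘ R`, which commutes with integrals. -/
theorem formOp_iff {R : H →L[ℝ] V}
    (h1 : ∀ f φ, a (R f) φ + lam * inner ℝ (j (R f)) (j φ) = inner ℝ f (j φ))
    (h2 : ∀ f v, (∀ φ, a v φ + lam * inner ℝ (j v) (j φ) = inner ℝ f (j φ)) → v = R f) (x w : H) :
    FormOp j a x w ↔ x = j (R (lam • x - w)) := by
  constructor
  · rintro ⟨v, rfl, hv⟩
    conv_lhs => rw [h2 (lam • j v - w) v fun φ => by
      rw [hv, inner_sub_left, inner_neg_left, real_inner_smul_left]; ring]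
  · intro hx
    refine ⟨R (lam • x - w), hx.symm, fun φ => ?_⟩
    have := h1 (lam • x - w) φ
    rw [← hx, inner_sub_left, real_inner_smul_left] at this
    rw [inner_neg_left]; linarith

/-- The Hilbert space adjoint of the operator of a form is the operator of the adjoint form. -/
theorem formOp_flip_of_adjoint [CompleteSpace H] [CompleteSpace V] (hc : 0 < c)
    (hcoer : ∀ v, c * ‖v‖ ^ 2 ≤ a v v + lam * ‖j v‖ ^ 2) {u w : H}
    (h : ∀ v z, FormOp j a v z → inner ℝ z u = inner ℝ v w) : FormOp j a.flip u w := by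
  obtain ⟨R, h1, h2⟩ := exists_weak_resolvent hc hcoer
  obtain ⟨R', h1', h2'⟩ := exists_weak_resolvent (a := a.flip) (j := j) hc hcoer
  rw [formOp_iff h1' h2']
  refine ext_inner_left ℝ fun f => ?_
  -- The vectors `j (R f)` lie in the domain of the operator, and `e2`, `e3` say that `j ∘ R` and `j
  -- ∘ R'` are adjoint to each other.
  have e1 := h (j (R f)) (lam • j (R f) - f) ((formOp_iff h1 h2 _ _).2 (by simp))
  have e2 := h1 f (R' (lam • u - w))
  have e3 := h1' (lam • u - w) (R f)
  rw [ContinuousLinearMap.flip_apply, real_inner_comm] at e3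
  rw [← e2, e3]
  simp only [inner_sub_left, real_inner_smul_left] at e1 ⊢
  rw [real_inner_comm (j (R f)) u, real_inner_comm (j (R f)) w]
  linarith

/-- Testing a mild solution that vanishes at time `T` against a weight `g(t)`. -/
theorem formOp_integral_smul [CompleteSpace H] [CompleteSpace V] (hc : 0 < c)
    (hcoer : ∀ v, c * ‖v‖ ^ 2 ≤ a v v + lam * ‖j v‖ ^ 2)
    {u : ℝ → H} {u₀ : H} (hT : 0 ≤ T)
    (hu : Continuous u) (hsol : ∀ t ∈ Icc 0 T, FormOp j a (∫ s in (0 : ℝ)..t, u s) (u t - u₀))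
    (huT : u T = 0) {g g' : ℝ → ℝ} (hg : ∀ t, HasDerivAt g (g' t) t) (hg' : Continuous g') :
    FormOp j a (∫ t in (0 : ℝ)..T, g t • u t)
      (-(g 0 • u₀) - ∫ t in (0 : ℝ)..T, g' t • u t) := by
  obtain ⟨R, h1, h2⟩ := exists_weak_resolvent hc hcoer
  simp only [formOp_iff h1 h2] at hsol ⊢
  set U : ℝ → H := fun t => ∫ s in (0 : ℝ)..t, u s with hU
  have hUd : ∀ t, HasDerivAt U (u t) t := fun t => hu.integral_hasStrictDerivAt 0 t |>.hasDerivAt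
  have hUc : Continuous U := continuous_iff_continuousAt.2 fun t => (hUd t).continuousAt
  -- The equation is known for the primitive `U`, so the derivative is moved from `U` to the weight.
  have hparts : ∫ t in (0 : ℝ)..T, g t • u t = g T • U T - ∫ t in (0 : ℝ)..T, g' t • U t := by
    have := intervalIntegral.integral_smul_deriv_eq_deriv_smul (a := 0) (b := T)
      (fun x _ => hg x) (fun x _ => hUd x) (hg'.intervalIntegrable _ _) (hu.intervalIntegrable _ _)
    simpa [hU] using this
  have hg'i : ∫ t in (0 : ℝ)..T, g' t = g T - g 0 :=
    intervalIntegral.integral_eq_sub_of_hasDerivAt (fun x _ => hg x) (hg'.intervalIntegrable _ _)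
  -- The resolvent identity for `U t` is multiplied by `g' t` and integrated; `j ∘ R` passes through
  -- the integral.
  have key : ∫ t in (0 : ℝ)..T, g' t • U t = j (R (lam • (∫ t in (0 : ℝ)..T, g' t • U t)
      - (∫ t in (0 : ℝ)..T, g' t • u t) + (g T - g 0) • u₀)) := by
    have : ∫ t in (0 : ℝ)..T, g' t • U t =
        ∫ t in (0 : ℝ)..T, (j ∘L R) (lam • (g' t • U t) - g' t • u t + g' t • u₀) := by
      refine intervalIntegral.integral_congr fun t ht => ?_
      rw [uIcc_of_le hT] at ht
      have := hsol t ht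
      conv_lhs => rw [hU]; beta_reduce; rw [this]
      rw [← map_smul, ← map_smul]
      simp only [ContinuousLinearMap.comp_apply]
      congr 2
      simp only [hU]
      module
    conv_lhs => rw [this]
    rw [ContinuousLinearMap.intervalIntegral_comp_comm _
      (Continuous.intervalIntegrable (by fun_prop) _ _), intervalIntegral.integral_add
      (Continuous.intervalIntegrable (by fun_prop) _ _)
      (Continuous.intervalIntegrable (by fun_prop) _ _), intervalIntegral.integral_sub
      (Continuous.intervalIntegrable (by fun_prop) _ _)
      (Continuous.intervalIntegrable (by fun_prop) _ _), intervalIntegral.integral_smul,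
      intervalIntegral.integral_smul_const, hg'i]
    rfl
  have hTT := hsol T ⟨hT, le_rfl⟩
  rw [huT] at hTT
  change U T = j (R (lam • U T - _)) at hTT
  rw [hparts]
  conv_lhs => rw [key, hTT]
  rw [← map_smul, ← map_smul, ← map_sub, ← map_sub]
  congr 2
  module

/-- The energy estimate for the resolvent equation `(x + i y - 𝒜)(h₁ + i h₂) = u₀`. -/
theorem resolvent_energy {h₁ h₂ u₀ : H} {x y : ℝ}
    (hcoer : ∀ v, c * ‖v‖ ^ 2 ≤ a v v + lam * ‖j v‖ ^ 2)
    (hskew : ∀ u v, |a u v - a v u| ≤ C * (‖u‖ * ‖j v‖ + ‖v‖ * ‖j u‖))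
    (e₁ : FormOp j a h₁ (-u₀ + x • h₁ - y • h₂)) (e₂ : FormOp j a h₂ (x • h₂ + y • h₁)) :
    ∃ N₁ N₂ : ℝ, c * (N₁ ^ 2 + N₂ ^ 2) + (x - lam) * (‖h₁‖ ^ 2 + ‖h₂‖ ^ 2) ≤ ‖u₀‖ * ‖h₁‖ ∧
      |y| * (‖h₁‖ ^ 2 + ‖h₂‖ ^ 2) ≤ C * (N₁ * ‖h₂‖ + N₂ * ‖h₁‖) + ‖u₀‖ * ‖h₂‖ := by
  obtain ⟨v₁, rfl, e₁⟩ := e₁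
  obtain ⟨v₂, rfl, e₂⟩ := e₂
  have a11 := e₁ v₁
  have a12 := e₁ v₂
  have a21 := e₂ v₁
  have a22 := e₂ v₂
  simp only [neg_add, neg_sub, inner_add_left, inner_sub_left, inner_neg_left,
    real_inner_smul_left, real_inner_self_eq_norm_sq] at a11 a12 a21 a22
  rw [real_inner_comm] at a21
  have i1 := real_inner_le_norm u₀ (j v₁)
  have i2 := abs_real_inner_le_norm u₀ (j v₂)
  refine ⟨‖v₁‖, ‖v₂‖, ?_, ?_⟩
  · have c1 := hcoer v₁
    have c2 := hcoer v₂
    rw [real_inner_comm] at a11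
    linarith
  · have hs := hskew v₁ v₂
    -- Testing each equation with the other unknown and subtracting cancels the `x` terms and leaves
    -- only the skew part of `a`.
    have e : y * (‖j v₁‖ ^ 2 + ‖j v₂‖ ^ 2) = (a v₁ v₂ - a v₂ v₁) - inner ℝ u₀ (j v₂) := by
      have := real_inner_comm (j v₁) (j v₂)
      rw [a12, a21]; linarith
    calc |y| * (‖j v₁‖ ^ 2 + ‖j v₂‖ ^ 2) = |y * (‖j v₁‖ ^ 2 + ‖j v₂‖ ^ 2)| := by
          rw [abs_mul, abs_of_nonneg (a := _ + _) (by positivity)]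
      _ ≤ |a v₁ v₂ - a v₂ v₁| + |inner ℝ u₀ (j v₂)| := by rw [e]; exact abs_sub _ _
      _ ≤ _ := add_le_add hs i2

end FormOp

/-! ### Complex analysis of the finite Laplace transform -/

section Laplace

variable {f : ℝ → ℝ} {T : ℝ}

/-- The Laplace transform of a continuous function on a bounded interval is entire. -/
theorem differentiable_laplace (hf : Continuous f) :
    Differentiable ℂ fun z : ℂ => ∫ t in (0 : ℝ)..T, Complex.exp (-(z * t)) * (f t : ℂ) := by
  intro z₀
  obtain ⟨B, hB⟩ := (isCompact_closedBall z₀ (1 : ℝ)).prod (isCompact_uIcc (a := (0 : ℝ)) (b := T))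
    |>.exists_bound_of_continuousOn
      (f := fun p : ℂ × ℝ => Complex.exp (-(p.1 * p.2)) * -(p.2 : ℂ) * (f p.2 : ℂ))
      (Continuous.continuousOn (by fun_prop))
  refine (intervalIntegral.hasDerivAt_integral_of_dominated_loc_of_deriv_le (𝕜 := ℂ)
    (F' := fun z t => Complex.exp (-(z * t)) * -(t : ℂ) * (f t : ℂ)) (bound := fun _ => B)
    (Metric.closedBall_mem_nhds z₀ one_pos) (Filter.Eventually.of_forall fun z => ?_) ?_ ?_ ?_ ?_
    ?_).2.differentiableAt
  · exact (Continuous.aestronglyMeasurable (by fun_prop))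
  · exact Continuous.intervalIntegrable (by fun_prop) _ _
  · exact (Continuous.aestronglyMeasurable (by fun_prop))
  · exact Filter.Eventually.of_forall fun t ht z hz => hB (z, t) ⟨hz, uIoc_subset_uIcc ht⟩
  · simp
  · refine Filter.Eventually.of_forall fun t ht z hz => ?_
    have : HasDerivAt (fun z : ℂ => -(z * t)) (-(t : ℂ)) z := by
      simpa using ((hasDerivAt_id' z).mul_const (t : ℂ)).fun_neg
    exact this.cexp.mul_const _

theorem norm_laplace_le (hT : 0 ≤ T) (hf : Continuous f) :
    ∃ B, 0 ≤ B ∧ ∀ z : ℂ, ‖∫ t in (0 : ℝ)..T, Complex.exp (-(z * t)) * (f t : ℂ)‖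
      ≤ B * Real.exp (T * ‖z‖) := by
  obtain ⟨B, hB⟩ := (isCompact_Icc (a := (0 : ℝ)) (b := T)).exists_bound_of_continuousOn
    hf.continuousOn
  have hB0 : 0 ≤ B := (norm_nonneg _).trans (hB 0 ⟨le_rfl, hT⟩)
  refine ⟨B * T, by positivity, fun z => ?_⟩
  have : ∀ t ∈ uIoc (0 : ℝ) T, ‖Complex.exp (-(z * t)) * (f t : ℂ)‖ ≤ Real.exp (T * ‖z‖) * B := by
    intro t ht
    rw [uIoc_of_le hT] at ht
    rw [norm_mul, Complex.norm_real]
    gcongr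
    · refine (Complex.norm_exp_le_exp_norm _).trans (Real.exp_le_exp.2 ?_)
      rw [norm_neg, norm_mul, Complex.norm_real, Real.norm_of_nonneg ht.1.le, mul_comm]
      gcongr
      exact ht.2
    · exact hB t ⟨ht.1.le, ht.2⟩
  refine (intervalIntegral.norm_integral_le_of_norm_le_const this).trans (le_of_eq ?_)
  rw [sub_zero, abs_of_nonneg hT]; ring

/-- Phragmén-Lindelöf and Liouville: an entire function of exponential type that decays outside
a sector of opening `π / 2` vanishes. -/
theorem eq_zero_of_sector_bound {F : ℂ → ℂ} {B A κ M : ℝ} (hF : Differentiable ℂ F)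
    (hB : ∀ z, ‖F z‖ ≤ B * Real.exp (A * ‖z‖)) (hA : 0 ≤ A) (hB0 : 0 ≤ B)
    (hM : ∀ z : ℂ, (2 * |z.im| + z.re - κ) * ‖F z‖ ≤ M) (z : ℂ) : F z = 0 := by
  -- The vertex `α` is far enough to the right that the factor in `hM` is at least `1` wherever `α -
  -- z.re ≤ |z.im|`.
  set α : ℝ := max κ 0 + 1
  have hα : κ + 1 ≤ α := by simp [α]
  have hα0 : 1 ≤ α := by simp [α]
  have hout : ∀ z : ℂ, α - z.re ≤ |z.im| → ‖F z‖ ≤ M := by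
    intro z hz
    have h1 : 1 ≤ 2 * |z.im| + z.re - κ := by
      rcases le_total z.re α with h | h
      · linarith
      · linarith [abs_nonneg z.im]
    calc ‖F z‖ = 1 * ‖F z‖ := (one_mul _).symm
      _ ≤ _ := mul_le_mul_of_nonneg_right h1 (norm_nonneg _)
      _ ≤ M := hM z
  -- The map `w ↦ α + (-1 + i) w` sends the first quadrant onto the remaining sector, and its two
  -- half-axes onto the sides. Growth of order `1` is below the critical order `2` of a quadrant.
  have hin : ∀ w : ℂ, 0 ≤ w.re → 0 ≤ w.im → ‖F (α + (-1 + Complex.I) * w)‖ ≤ M := by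
    intro w hw1 hw2
    refine PhragmenLindelof.quadrant_I (f := fun w => F (α + (-1 + Complex.I) * w))
      (Differentiable.diffContOnCl (by fun_prop)) ⟨1, by norm_num, 2 * A, ?_⟩
      (fun x hx => hout _ ?_) (fun x hx => hout _ ?_) hw1 hw2
    · refine Asymptotics.IsBigO.of_bound (B * Real.exp (A * α))
        (Filter.Eventually.of_forall fun w => (hB _).trans ?_)
      rw [Real.norm_of_nonneg (Real.exp_pos _).le, mul_assoc, ← Real.exp_add, Real.rpow_one]
      gcongr
      have : ‖(α : ℂ) + (-1 + Complex.I) * w‖ ≤ α + 2 * ‖w‖ := by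
        refine (norm_add_le _ _).trans ?_
        rw [Complex.norm_real, Real.norm_of_nonneg (by linarith), norm_mul]
        gcongr
        refine (norm_add_le _ _).trans ?_
        norm_num
      nlinarith
    · simp [abs_of_nonneg hx]
    · simp [abs_of_nonneg hx]
  have hall : ∀ z, ‖F z‖ ≤ M := by
    intro z
    by_cases hz : α - z.re ≤ |z.im|
    · exact hout z hz
    -- `(-1 - i) / 2` is the inverse of `-1 + i`.
    · have key := hin ((z - α) * ((-1 - Complex.I) / 2)) ?_ ?_
      · convert key using 3
        have : (-1 + Complex.I) * ((z - α) * ((-1 - Complex.I) / 2)) =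
          (z - α) * ((1 - Complex.I ^ 2) / 2) := by ring
        rw [this, Complex.I_sq]; ring
      all_goals
        have h1 := abs_lt.1 (not_le.1 hz)
        simp
        linarith [h1.1, h1.2]
  have hconst : ∀ w, F w = F z := fun w => hF.apply_eq_apply_of_bounded
    (isBounded_iff_forall_norm_le.2 ⟨M, by rintro _ ⟨z, rfl⟩; exact hall z⟩) w z
  by_contra hne
  have hpos : 0 < ‖F z‖ := norm_pos_iff.2 hne
  -- At this real point a nonzero constant value would force `|M| + 1 ≤ M`.
  have := hM ((κ + (|M| + 1) / ‖F z‖ : ℝ) : ℂ)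
  rw [hconst ((κ + (|M| + 1) / ‖F z‖ : ℝ) : ℂ), Complex.ofReal_im, Complex.ofReal_re] at this
  have e : (2 * |(0 : ℝ)| + (κ + (|M| + 1) / ‖F z‖) - κ) * ‖F z‖ = |M| + 1 := by
    rw [abs_zero]; field_simp; ring
  linarith [le_abs_self M]

/-- A continuous function whose Laplace transform over `(0, T)` decays outside a sector of opening
`π / 2` vanishes. -/
theorem eq_zero_of_laplace_bound {κ M : ℝ} (hT : 0 ≤ T) (hf : Continuous f)
    (hM : ∀ z : ℂ, (2 * |z.im| + z.re - κ) *
      ‖∫ t in (0 : ℝ)..T, Complex.exp (-(z * t)) * (f t : ℂ)‖ ≤ M) : ∀ t ∈ Ioo 0 T, f t = 0 := by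
  obtain ⟨B, hB0, hB⟩ := norm_laplace_le hT hf
  have hzero := eq_zero_of_sector_bound (differentiable_laplace hf) hB hT hB0 hM
  set g : ℝ → ℂ := (Ioc 0 T).indicator fun t => (f t : ℂ)
  have hgi : Integrable g :=
    (integrable_indicator_iff measurableSet_Ioc).2
      ((Continuous.integrableOn_Icc (by fun_prop)).mono_set Ioc_subset_Icc_self)
  have hg : FourierTransform.fourier g = 0 := by
    ext ξ
    -- The Fourier transform at `ξ` is the Laplace transform at `2πiξ`.
    rw [Real.fourier_real_eq_integral_exp_smul, Pi.zero_apply,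
      ← hzero (2 * Real.pi * Complex.I * ξ), intervalIntegral.integral_of_le hT,
      ← integral_indicator measurableSet_Ioc]
    refine integral_congr_ae (Filter.Eventually.of_forall fun t => ?_)
    by_cases ht : t ∈ Ioc 0 T
    · simp only [g, indicator_of_mem ht, smul_eq_mul]
      congr 2
      push_cast; ring
    · simp [g, indicator_of_notMem ht]
  intro t ht
  have hev : g =ᶠ[nhds t] fun t => (f t : ℂ) := by
    filter_upwards [Ioo_mem_nhds ht.1 ht.2] with s hs
    exact indicator_of_mem (Ioo_subset_Ioc_self hs) _
  have hc : ContinuousAt g t := (ContinuousAt.congr_of_eventuallyEq (by fun_prop) hev)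
  have := hgi.fourierInv_fourier_eq (by rw [hg]; exact integrable_zero _ _ _) hc
  rw [hg, hev.eq_of_nhds] at this
  have h0 : FourierTransformInv.fourierInv (0 : ℝ → ℂ) t = 0 := by
    simp [Real.fourierInv_eq']
  rw [h0] at this
  exact_mod_cast this.symm

end Laplace

/-! ### Resolvent bound and abstract backward uniqueness -/

section BackwardUniqueness

variable {H V : Type*} [NormedAddCommGroup H] [InnerProductSpace ℝ H] [CompleteSpace H]
  [NormedAddCommGroup V] [InnerProductSpace ℝ V] [CompleteSpace V]
  {j : V →L[ℝ] H} {a : V →L[ℝ] V →L[ℝ] ℝ} {c lam C T : ℝ}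

/-- In `h₁ + 2 h₂`, Young's inequality absorbs the `N` terms into `c (N₁² + N₂²)` at the price `C² /
c`, which enters the shift. Dividing by `m₁ + m₂`, with `(m₁ + m₂)² ≤ 2 (m₁² + m₂²)`, produces the
constant `4`. -/
theorem resolvent_bound_of_energy {c lam C x y m₁ m₂ N₁ N₂ U : ℝ} (hc : 0 < c) (hU : 0 ≤ U)
    (hm₁ : 0 ≤ m₁) (hm₂ : 0 ≤ m₂)
    (h₁ : c * (N₁ ^ 2 + N₂ ^ 2) + (x - lam) * (m₁ ^ 2 + m₂ ^ 2) ≤ U * m₁)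
    (h₂ : |y| * (m₁ ^ 2 + m₂ ^ 2) ≤ C * (N₁ * m₂ + N₂ * m₁) + U * m₂) :
    (2 * |y| + x - (lam + C ^ 2 / c)) * (m₁ + m₂) ≤ 4 * U := by
  set s := 2 * |y| + x - (lam + C ^ 2 / c) with hs
  have y₁ : 2 * (C * (N₁ * m₂)) ≤ c * N₁ ^ 2 + C ^ 2 / c * m₂ ^ 2 := by
    have : c * N₁ ^ 2 + C ^ 2 / c * m₂ ^ 2 - 2 * (C * (N₁ * m₂)) = (c * N₁ - C * m₂) ^ 2 / c := by
      field_simp; ring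
    have : 0 ≤ (c * N₁ - C * m₂) ^ 2 / c := by positivity
    linarith
  have y₂ : 2 * (C * (N₂ * m₁)) ≤ c * N₂ ^ 2 + C ^ 2 / c * m₁ ^ 2 := by
    have : c * N₂ ^ 2 + C ^ 2 / c * m₁ ^ 2 - 2 * (C * (N₂ * m₁)) = (c * N₂ - C * m₁) ^ 2 / c := by
      field_simp; ring
    have : 0 ≤ (c * N₂ - C * m₁) ^ 2 / c := by positivity
    linarith
  have key : s * (m₁ ^ 2 + m₂ ^ 2) ≤ U * (m₁ + 2 * m₂) := by
    rw [hs]; linarith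
  rcases le_or_gt s 0 with h | h
  · nlinarith [mul_nonneg (neg_nonneg.2 h) (add_nonneg hm₁ hm₂)]
  · rcases (add_nonneg hm₁ hm₂).eq_or_lt with h0 | h0
    · rw [← h0]; linarith
    · refine le_of_mul_le_mul_right ?_ h0
      have : s * (m₁ + m₂) ^ 2 ≤ 2 * (s * (m₁ ^ 2 + m₂ ^ 2)) := by
        nlinarith [mul_nonneg h.le (sq_nonneg (m₁ - m₂))]
      nlinarith [mul_nonneg hU hm₁]

/-- Decay, outside a sector, of the Laplace transform of a mild solution vanishing at time `T`. -/
theorem laplace_bound (hc : 0 < c)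
    (hcoer : ∀ v, c * ‖v‖ ^ 2 ≤ a v v + lam * ‖j v‖ ^ 2)
    (hskew : ∀ u v, |a u v - a v u| ≤ C * (‖u‖ * ‖j v‖ + ‖v‖ * ‖j u‖)) (hT : 0 ≤ T)
    {u : ℝ → H} {u₀ : H} (hu : Continuous u)
    (hsol : ∀ t ∈ Icc 0 T, FormOp j a (∫ s in (0 : ℝ)..t, u s) (u t - u₀)) (huT : u T = 0)
    (ψ : H) (z : ℂ) :
    (2 * |z.im| + z.re - (lam + C ^ 2 / c)) *
      ‖∫ t in (0 : ℝ)..T, Complex.exp (-(z * t)) * ((inner ℝ ψ (u t) : ℝ) : ℂ)‖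
        ≤ 4 * ‖u₀‖ * ‖ψ‖ := by
  set x := z.re
  set y := z.im
  -- As `H` is real, `e^{-zt}` is split into its real part `g₁` and imaginary part `g₂`. Since `g₁ 0
  -- = 1` and `g₂ 0 = 0`, the datum `u₀` enters only the first equation.
  set g₁ : ℝ → ℝ := fun t => Real.exp (-(x * t)) * Real.cos (y * t) with hg₁
  set g₂ : ℝ → ℝ := fun t => -(Real.exp (-(x * t)) * Real.sin (y * t)) with hg₂
  have dexp : ∀ t, HasDerivAt (fun t => Real.exp (-(x * t))) (Real.exp (-(x * t)) * -x) t :=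
    fun t => by simpa using (((hasDerivAt_id' t).const_mul x).fun_neg).exp
  have d₁ : ∀ t, HasDerivAt g₁ (-x * g₁ t + y * g₂ t) t := fun t => by
    refine ((dexp t).fun_mul (((hasDerivAt_id' t).const_mul y).cos)).congr_deriv ?_
    simp only [g₁, g₂]; ring
  have d₂ : ∀ t, HasDerivAt g₂ (-x * g₂ t - y * g₁ t) t := fun t => by
    refine ((dexp t).fun_mul (((hasDerivAt_id' t).const_mul y).sin)).fun_neg.congr_deriv ?_
    simp only [g₁, g₂]; ring
  have c₁ : Continuous g₁ := by fun_prop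
  have c₂ : Continuous g₂ := by fun_prop
  have i₁ : IntervalIntegrable (fun t => g₁ t • u t) volume 0 T :=
    Continuous.intervalIntegrable (by fun_prop) _ _
  have i₂ : IntervalIntegrable (fun t => g₂ t • u t) volume 0 T :=
    Continuous.intervalIntegrable (by fun_prop) _ _
  set h₁ : H := ∫ t in (0 : ℝ)..T, g₁ t • u t
  set h₂ : H := ∫ t in (0 : ℝ)..T, g₂ t • u t
  have e₁ : FormOp j a h₁ (-u₀ + x • h₁ - y • h₂) := by
    convert formOp_integral_smul hc hcoer hT hu hsol huT d₁ (by fun_prop) using 1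
    have : ∫ t in (0 : ℝ)..T, (-x * g₁ t + y * g₂ t) • u t = -x • h₁ + y • h₂ := by
      simp only [add_smul, mul_smul]
      rw [intervalIntegral.integral_add
        (Continuous.intervalIntegrable (by fun_prop) _ _)
        (Continuous.intervalIntegrable (by fun_prop) _ _), intervalIntegral.integral_smul,
        intervalIntegral.integral_smul]
    rw [this]
    simp [g₁]
    module
  have e₂ : FormOp j a h₂ (x • h₂ + y • h₁) := by
    convert formOp_integral_smul hc hcoer hT hu hsol huT d₂ (by fun_prop) using 1
    have : ∫ t in (0 : ℝ)..T, (-x * g₂ t - y * g₁ t) • u t = -x • h₂ - y • h₁ := by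
      simp only [sub_smul, mul_smul]
      rw [intervalIntegral.integral_sub
        (Continuous.intervalIntegrable (by fun_prop) _ _)
        (Continuous.intervalIntegrable (by fun_prop) _ _), intervalIntegral.integral_smul,
        intervalIntegral.integral_smul]
    rw [this]
    simp [g₂]
    module
  obtain ⟨N₁, N₂, b₁, b₂⟩ := resolvent_energy hcoer hskew e₁ e₂
  have hb := resolvent_bound_of_energy hc (norm_nonneg u₀) (norm_nonneg _) (norm_nonneg _) b₁ b₂
  have hF : ∫ t in (0 : ℝ)..T, Complex.exp (-(z * t)) * ((inner ℝ ψ (u t) : ℝ) : ℂ)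
      = ((inner ℝ ψ h₁ : ℝ) : ℂ) + Complex.I * ((inner ℝ ψ h₂ : ℝ) : ℂ) := by
    have r₁ : inner ℝ ψ h₁ = ∫ t in (0 : ℝ)..T, g₁ t * inner ℝ ψ (u t) := by
      simpa [inner_smul_right] using
        ((innerSL ℝ ψ).intervalIntegral_comp_comm i₁).symm
    have r₂ : inner ℝ ψ h₂ = ∫ t in (0 : ℝ)..T, g₂ t * inner ℝ ψ (u t) := by
      simpa [inner_smul_right] using
        ((innerSL ℝ ψ).intervalIntegral_comp_comm i₂).symm
    rw [r₁, r₂, ← intervalIntegral.integral_ofReal, ← intervalIntegral.integral_ofReal,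
      ← intervalIntegral.integral_const_mul, ← intervalIntegral.integral_add
      (Continuous.intervalIntegrable (by fun_prop) _ _)
      (Continuous.intervalIntegrable (by fun_prop) _ _)]
    refine intervalIntegral.integral_congr fun t _ => ?_
    have : Complex.exp (-(z * t)) = (g₁ t : ℂ) + Complex.I * (g₂ t : ℂ) := by
      have k₁ := Complex.cos_ofReal_re (z.im * t)
      have k₂ := Complex.cos_ofReal_im (z.im * t)
      have k₃ := Complex.sin_ofReal_re (z.im * t)
      have k₄ := Complex.sin_ofReal_im (z.im * t)
      push_cast at k₁ k₂ k₃ k₄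
      apply Complex.ext <;> simp [Complex.exp_re, Complex.exp_im, g₁, g₂, x, y, k₁, k₂, k₃, k₄]
    simp only [this]
    push_cast; ring
  have hn : ‖∫ t in (0 : ℝ)..T, Complex.exp (-(z * t)) * ((inner ℝ ψ (u t) : ℝ) : ℂ)‖
      ≤ (‖h₁‖ + ‖h₂‖) * ‖ψ‖ := by
    rw [hF]
    refine (norm_add_le _ _).trans ?_
    rw [norm_mul, Complex.norm_I, one_mul, Complex.norm_real, Complex.norm_real]
    linarith [norm_inner_le_norm (𝕜 := ℝ) ψ h₁, norm_inner_le_norm (𝕜 := ℝ) ψ h₂]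
  rcases le_or_gt (2 * |y| + x - (lam + C ^ 2 / c)) 0 with h | h
  · exact (mul_nonpos_of_nonpos_of_nonneg h (norm_nonneg _)).trans (by positivity)
  · calc _ ≤ (2 * |y| + x - (lam + C ^ 2 / c)) * ((‖h₁‖ + ‖h₂‖) * ‖ψ‖) := by gcongr
      _ = ((2 * |y| + x - (lam + C ^ 2 / c)) * (‖h₁‖ + ‖h₂‖)) * ‖ψ‖ := by ring
      _ ≤ _ := by gcongr

/-- Backward uniqueness for the operator of a coercive form with first order skew part. -/
theorem backward_uniqueness (hc : 0 < c)
    (hcoer : ∀ v, c * ‖v‖ ^ 2 ≤ a v v + lam * ‖j v‖ ^ 2)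
    (hskew : ∀ u v, |a u v - a v u| ≤ C * (‖u‖ * ‖j v‖ + ‖v‖ * ‖j u‖)) (hT : 0 < T)
    {u : ℝ → H} {u₀ : H} (hu : ContinuousOn u (Icc 0 T)) (hu0 : u 0 = u₀)
    (hsol : ∀ t ∈ Icc 0 T, FormOp j a (∫ s in (0 : ℝ)..t, u s) (u t - u₀)) (huT : u T = 0) :
    u₀ = 0 := by
  -- Constant extension beyond `[0, T]` provides a globally continuous function without changing the
  -- integrals in the equation.
  set w : ℝ → H := IccExtend hT.le ((Icc 0 T).domRestrict u) with hw
  have hwc : Continuous w := (continuousOn_iff_continuous_domRestrict.1 hu).Icc_extend'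
  have hwu : ∀ t ∈ Icc 0 T, w t = u t := fun t ht => IccExtend_of_mem hT.le _ ht
  have hwsol : ∀ t ∈ Icc 0 T, FormOp j a (∫ s in (0 : ℝ)..t, w s) (w t - u₀) := by
    intro t ht
    rw [hwu t ht, intervalIntegral.integral_congr (g := u) fun s hs => ?_]
    · exact hsol t ht
    · rw [uIcc_of_le ht.1] at hs
      exact hwu s ⟨hs.1, hs.2.trans ht.2⟩
  have hwT : w T = 0 := by rw [hwu T ⟨hT.le, le_rfl⟩, huT]
  have hz := eq_zero_of_laplace_bound (f := fun t => inner ℝ u₀ (w t)) hT.le (by fun_prop)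
    (laplace_bound hc hcoer hskew hT.le hwc hwsol hwT u₀)
  have hcl : EqOn (fun t => inner ℝ u₀ (w t)) (fun _ => (0 : ℝ)) (closure (Ioo 0 T)) :=
    EqOn.closure hz (by fun_prop) continuous_const
  rw [closure_Ioo hT.ne] at hcl
  have := hcl ⟨le_rfl, hT.le⟩
  simpa [hwu 0 ⟨le_rfl, hT.le⟩, hu0] using this

end BackwardUniqueness

/-! ### Surface measures, restriction maps and test functions -/

namespace AdvDiff

/-- This makes preimages of compact sets compact, so surface measures are finite on compacts and
test functions are square integrable on `∂Ω`. -/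
theorem isometry_atHeight {d : ℕ} (c : ℝ) : Isometry (atHeight (d := d) c) := by
  refine Isometry.of_dist_eq fun x y => ?_
  rw [EuclideanSpace.dist_eq, EuclideanSpace.dist_eq, Fin.sum_univ_castSucc]
  simp [atHeight]

instance isFiniteMeasureOnCompacts_surf (d : ℕ) (c : ℝ) :
    IsFiniteMeasureOnCompacts (surf d c) := by
  refine ⟨fun K hK => ?_⟩
  rw [surf, Measure.map_apply (continuous_atHeight c).measurable hK.measurableSet]
  exact ((isometry_atHeight c).isClosedEmbedding.isCompact_preimage hK).measure_lt_top

instance isFiniteMeasureOnCompacts_bdry (d : ℕ) (L : ℝ) :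
    IsFiniteMeasureOnCompacts (bdry d L) :=
  ⟨fun K hK => by
    rw [bdry, Measure.add_apply]
    exact ENNReal.add_lt_top.2 ⟨hK.measure_lt_top, hK.measure_lt_top⟩⟩

section Measures

variable (d : ℕ) (L : ℝ) {ε : ℝ}

theorem restrict_Omega_le (ε : ℝ) :
    volume.restrict (Omega d L) ≤ (1 : ENNReal) • muX d L ε := by
  rw [one_smul]; exact Measure.le_add_right le_rfl

/-- The boundary part of `muX` carries the weight `ε`; dividing by it makes restriction to `∂Ω`
continuous on `X`. -/
theorem bdry_le (hε : 0 < ε) : bdry d L ≤ (ENNReal.ofReal ε)⁻¹ • muX d L ε := by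
  have h0 : ENNReal.ofReal ε ≠ 0 := by simpa using hε
  rw [muX, smul_add, smul_smul, ENNReal.inv_mul_cancel h0 ENNReal.ofReal_ne_top, one_smul]
  exact Measure.le_add_left le_rfl

theorem surf_le (hε : 0 < ε) : surf d (-L) ≤ (ENNReal.ofReal ε)⁻¹ • muX d L ε :=
  (Measure.le_add_left le_rfl).trans (bdry_le d L hε)

theorem inv_ofReal_ne_top (hε : 0 < ε) : (ENNReal.ofReal ε)⁻¹ ≠ ⊤ := by simpa using hε

/-- Restriction to `Ω`. -/
noncomputable def toOmega (ε : ℝ) :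
    X d L ε →L[ℝ] Lp ℝ 2 (volume.restrict (Omega d L) : Measure (Pt d)) :=
  Lp.LpToLpOfMeasureLeSMul ENNReal.one_ne_top (restrict_Omega_le d L ε) ∘L (X d L ε).subtypeL

/-- Restriction to `∂Ω`. -/
noncomputable def toBdry (hε : 0 < ε) : X d L ε →L[ℝ] Lp ℝ 2 (bdry d L) :=
  Lp.LpToLpOfMeasureLeSMul (inv_ofReal_ne_top hε) (bdry_le d L hε) ∘L (X d L ε).subtypeL

/-- Restriction to `Γ₁`. -/
noncomputable def toSurf (hε : 0 < ε) : X d L ε →L[ℝ] Lp ℝ 2 (surf d (-L)) :=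
  Lp.LpToLpOfMeasureLeSMul (inv_ofReal_ne_top hε) (surf_le d L hε) ∘L (X d L ε).subtypeL

variable {d L}

theorem coeFn_toOmega (u : X d L ε) :
    toOmega d L ε u =ᵐ[volume.restrict (Omega d L)] (u : Lp ℝ 2 (muX d L ε)) :=
  Lp.coeFn_LpToLpOfMeasureLeSMul ENNReal.one_ne_top (restrict_Omega_le d L ε) _

theorem coeFn_toBdry (hε : 0 < ε) (u : X d L ε) :
    toBdry d L hε u =ᵐ[bdry d L] (u : Lp ℝ 2 (muX d L ε)) :=
  Lp.coeFn_LpToLpOfMeasureLeSMul (inv_ofReal_ne_top hε) (bdry_le d L hε) _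

theorem coeFn_toSurf (hε : 0 < ε) (u : X d L ε) :
    toSurf d L hε u =ᵐ[surf d (-L)] (u : Lp ℝ 2 (muX d L ε)) :=
  Lp.coeFn_LpToLpOfMeasureLeSMul (inv_ofReal_ne_top hε) (surf_le d L hε) _

end Measures

theorem inner_Lp_eq_integral_mul {α : Type*} [MeasurableSpace α] {μ : Measure α}
    (f g : Lp ℝ 2 μ) : inner ℝ f g = ∫ x, f x * g x ∂μ := by
  rw [L2.inner_def]
  simp [mul_comm]

theorem inner_toLp_eq_integral_mul {α : Type*} [MeasurableSpace α] {μ : Measure α} {h k : α → ℝ}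
    (hh : MemLp h 2 μ) (f : Lp ℝ 2 μ) (hk : f =ᵐ[μ] k) :
    inner ℝ (hh.toLp h) f = ∫ x, k x * h x ∂μ := by
  rw [inner_Lp_eq_integral_mul]
  refine integral_congr_ae ?_
  filter_upwards [hk, hh.coeFn_toLp] with x h1 h2
  rw [h1, h2, mul_comm]

section TestFunctions

variable {d : ℕ} {L ε : ℝ} {φ : Pt d → ℝ}

theorem IsTest.memLp (hφ : IsTest φ) (μ : Measure (Pt d)) [IsFiniteMeasureOnCompacts μ] :
    MemLp φ 2 μ :=
  hφ.1.continuous.memLp_of_hasCompactSupport hφ.2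

theorem IsTest.memLp_partialD (hφ : IsTest φ) (i : Fin (d + 1)) (μ : Measure (Pt d))
    [IsFiniteMeasureOnCompacts μ] : MemLp (partialD i φ) 2 μ := by
  refine Continuous.memLp_of_hasCompactSupport ?_ (hφ.2.fderiv_apply ℝ _)
  exact (hφ.1.continuous_fderiv (by simp)).clm_apply continuous_const

theorem measurable_normal (i : Fin (d + 1)) : Measurable fun x : Pt d => normal x i := by
  have : (fun x : Pt d => normal x i) = fun x => if x (Fin.last d) = 0 then
      (EuclideanSpace.single (Fin.last d) (1 : ℝ) : Pt d) i
      else (-EuclideanSpace.single (Fin.last d) (1 : ℝ) : Pt d) i := by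
    ext x; unfold normal; split_ifs <;> rfl
  rw [this]
  refine Measurable.ite ?_ measurable_const measurable_const
  exact measurableSet_eq_fun (by fun_prop) measurable_const

theorem abs_normal_le (x : Pt d) (i : Fin (d + 1)) : |normal x i| ≤ 1 := by
  unfold normal
  split_ifs <;> by_cases h : i = Fin.last d <;> simp [h]

theorem IsTest.memLp_mul_normal (hφ : IsTest φ) (i : Fin (d + 1)) :
    MemLp (fun x => φ x * normal x i) 2 (bdry d L) := by
  refine (hφ.memLp (bdry d L)).mono
    (hφ.1.continuous.measurable.mul (measurable_normal i)).aestronglyMeasurable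
    (Filter.Eventually.of_forall fun x => ?_)
  rw [norm_mul]
  exact mul_le_of_le_one_right (norm_nonneg _) (abs_normal_le x i)

end TestFunctions

/-! ### `H¹(Ω)` as a closed subspace of value-gradient pairs -/

section Sobolev

variable {d : ℕ} {L ε : ℝ}

/-- Pairs of an element of `X` and a candidate for its gradient. -/
def Pairs (d : ℕ) (L ε : ℝ) : Type :=
  WithLp 2 (X d L ε × PiLp 2 fun _ : Fin (d + 1) =>
    Lp ℝ 2 (volume.restrict (Omega d L) : Measure (Pt d)))

noncomputable instance : NormedAddCommGroup (Pairs d L ε) :=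
  inferInstanceAs (NormedAddCommGroup (WithLp 2 (X d L ε × PiLp 2 fun _ : Fin (d + 1) =>
    Lp ℝ 2 (volume.restrict (Omega d L) : Measure (Pt d)))))

noncomputable instance : InnerProductSpace ℝ (Pairs d L ε) :=
  inferInstanceAs (InnerProductSpace ℝ (WithLp 2 (X d L ε × PiLp 2 fun _ : Fin (d + 1) =>
    Lp ℝ 2 (volume.restrict (Omega d L) : Measure (Pt d)))))

instance : CompleteSpace (Pairs d L ε) :=
  inferInstanceAs (CompleteSpace (WithLp 2 (X d L ε × PiLp 2 fun _ : Fin (d + 1) =>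
    Lp ℝ 2 (volume.restrict (Omega d L) : Measure (Pt d)))))

/-- The pair of `u` and `p`. -/
def Pairs.mk (u : X d L ε) (p : L2Grad d L) : Pairs d L ε := WithLp.toLp 2 (u, WithLp.toLp 2 p)

/-- The value part. -/
noncomputable def valL (d : ℕ) (L ε : ℝ) : Pairs d L ε →L[ℝ] X d L ε :=
  WithLp.fstL 2 ℝ (X d L ε) (PiLp 2 fun _ : Fin (d + 1) =>
    Lp ℝ 2 (volume.restrict (Omega d L) : Measure (Pt d)))

/-- The `i`-th component of the gradient part. -/
noncomputable def gradL (d : ℕ) (L ε : ℝ) (i : Fin (d + 1)) :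
    Pairs d L ε →L[ℝ] Lp ℝ 2 (volume.restrict (Omega d L) : Measure (Pt d)) :=
  PiLp.proj 2 (𝕜 := ℝ) _ i ∘L WithLp.sndL 2 ℝ (X d L ε) (PiLp 2 fun _ : Fin (d + 1) =>
    Lp ℝ 2 (volume.restrict (Omega d L) : Measure (Pt d)))

/-- The identities defining weak gradients and traces are linear and `L²`-continuous in the pair. As
conditions `l e = 0` they cut out a closed, hence complete, subspace. -/
theorem exists_interior_functional {φ : Pt d → ℝ} (hφ : IsTest φ) (i : Fin (d + 1)) :
    ∃ l : Pairs d L ε →L[ℝ] ℝ, ∀ e, l e =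
      (∫ x in Omega d L, (valL d L ε e : Lp ℝ 2 (muX d L ε)) x * partialD i φ x) +
        ∫ x in Omega d L, gradL d L ε i e x * φ x := by
  refine ⟨innerSL ℝ ((hφ.memLp_partialD i (volume.restrict (Omega d L))).toLp _) ∘L
    toOmega d L ε ∘L valL d L ε + innerSL ℝ ((hφ.memLp (volume.restrict (Omega d L))).toLp _) ∘L
    gradL d L ε i, fun e => ?_⟩
  rw [← inner_toLp_eq_integral_mul (hφ.memLp_partialD i _) _ (coeFn_toOmega (valL d L ε e)),
    ← inner_toLp_eq_integral_mul (hφ.memLp _) (gradL d L ε i e) Filter.EventuallyEq.rfl]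
  rfl

theorem exists_boundary_functional (hε : 0 < ε) {φ : Pt d → ℝ} (hφ : IsTest φ)
    (i : Fin (d + 1)) :
    ∃ l : Pairs d L ε →L[ℝ] ℝ, ∀ e, l e =
      ∫ x, (valL d L ε e : Lp ℝ 2 (muX d L ε)) x * φ x * normal x i ∂(bdry d L) := by
  refine ⟨innerSL ℝ ((hφ.memLp_mul_normal i).toLp _) ∘L toBdry d L hε ∘L valL d L ε, fun e => ?_⟩
  simp_rw [mul_assoc]
  rw [← inner_toLp_eq_integral_mul (hφ.memLp_mul_normal i) _ (coeFn_toBdry hε (valL d L ε e))]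
  rfl

/-- The Sobolev space is the common kernel of continuous functionals. -/
theorem exists_annihilator (hε : 0 < ε) :
    ∃ S : Set (Pairs d L ε →L[ℝ] ℝ), ∀ e : Pairs d L ε,
      IsH1 (valL d L ε e) (fun i => gradL d L ε i e) ↔ ∀ l ∈ S, l e = 0 := by
  choose l₁ h₁ using fun (φ : {φ : Pt d → ℝ // IsTest φ}) (i : Fin (d + 1)) =>
    exists_interior_functional (L := L) (ε := ε) φ.2 i
  choose l₂ h₂ using fun (φ : {φ : Pt d → ℝ // IsTest φ}) (i : Fin (d + 1)) =>
    exists_boundary_functional (L := L) hε φ.2 i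
  refine ⟨{l | ∃ φ i, tsupport φ.1 ⊆ Omega d L ∧ l = l₁ φ i} ∪ {l | ∃ φ i, l = l₁ φ i - l₂ φ i},
    fun e => ⟨?_, ?_⟩⟩
  · rintro ⟨hg, ht⟩ l (⟨φ, i, hs, rfl⟩ | ⟨φ, i, rfl⟩)
    · rw [h₁, hg φ.1 φ.2 hs i, neg_add_cancel]
    · rw [sub_apply, h₁, h₂, ht φ.1 φ.2 i, sub_self]
  · intro h
    refine ⟨fun φ hφ hs i => ?_, fun φ hφ i => ?_⟩
    · have := h _ (Or.inl ⟨⟨φ, hφ⟩, i, hs, rfl⟩)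
      rw [h₁] at this
      exact eq_neg_of_add_eq_zero_left this
    · have := h _ (Or.inr ⟨⟨φ, hφ⟩, i, rfl⟩)
      rw [sub_apply, h₁, h₂] at this
      exact sub_eq_zero.1 this

theorem norm_sq_pairs (e : Pairs d L ε) :
    ‖e‖ ^ 2 = ‖valL d L ε e‖ ^ 2 + ∑ i, ‖gradL d L ε i e‖ ^ 2 := by
  refine (WithLp.prod_norm_sq_eq_of_L2 _).trans ?_
  rw [PiLp.norm_sq_eq_of_L2]
  rfl

/-- The Sobolev space `V = H¹(Ω)` as a closed subspace of pairs. -/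
theorem exists_sobolev (hε : 0 < ε) :
    ∃ V : Submodule ℝ (Pairs d L ε), IsClosed (V : Set (Pairs d L ε)) ∧ ∀ e : Pairs d L ε,
      e ∈ V ↔ IsH1 (valL d L ε e) (fun i => gradL d L ε i e) := by
  obtain ⟨S, hS⟩ := exists_annihilator (d := d) (L := L) hε
  refine ⟨⨅ l ∈ S, LinearMap.ker (l : Pairs d L ε →ₗ[ℝ] ℝ), ?_, fun e => ?_⟩
  · simp only [Submodule.coe_iInf]
    exact isClosed_biInter fun l _ => ContinuousLinearMap.isClosed_ker l
  · rw [hS]; simp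

end Sobolev

/-! ### The advection-diffusion form: coercivity and skew part -/

section Form

variable {d : ℕ} {L ε : ℝ} {E : Type*} [NormedAddCommGroup E] [InnerProductSpace ℝ E]
  (val : E →L[ℝ] X d L ε)
  (gr : Fin (d + 1) → E →L[ℝ] Lp ℝ 2 (volume.restrict (Omega d L) : Measure (Pt d)))

/-- The form `a` on an abstract space of functions with values `val` and gradients `gr`. -/
noncomputable def formL (hε : 0 < ε) : E →L[ℝ] E →L[ℝ] ℝ :=
  ε • (∑ i, (innerSL ℝ).bilinearComp (gr i) (gr i))
    + (innerSL ℝ).bilinearComp (gr (Fin.last d)) (toOmega d L ε ∘L val)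
    + (innerSL ℝ).bilinearComp (toSurf d L hε ∘L val) (toSurf d L hε ∘L val)

theorem formL_apply (hε : 0 < ε) (e f : E) :
    formL val gr hε e f = ε * (∑ i, inner ℝ (gr i e) (gr i f))
      + inner ℝ (gr (Fin.last d) e) (toOmega d L ε (val f))
      + inner ℝ (toSurf d L hε (val e)) (toSurf d L hε (val f)) := by
  simp [formL]

theorem formL_eq_form (hε : 0 < ε) (e f : E) :
    formL val gr hε e f = form (val e) (fun i => gr i e) (val f) (fun i => gr i f) := by
  rw [formL_apply, form]
  congr 1
  · congr 1
    · rw [integral_finsetSum _ fun i _ => by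
        simpa [mul_comm] using L2.integrable_inner (𝕜 := ℝ) (gr i e) (gr i f)]
      simp_rw [inner_Lp_eq_integral_mul]
    · rw [inner_Lp_eq_integral_mul]
      refine integral_congr_ae ?_
      filter_upwards [coeFn_toOmega (val f)] with x hx
      rw [hx]
  · rw [inner_Lp_eq_integral_mul]
    refine integral_congr_ae ?_
    filter_upwards [coeFn_toSurf hε (val e), coeFn_toSurf hε (val f)] with x h1 h2
    rw [h1, h2]

/-- Here `m` is the norm in `X`, `g` that of `∂ₙu`, `G` the squared norm of the full gradient, `q`
the advection term and `b` the boundary term. Young's inequality spends half of the diffusion on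
`q`; the extra `ε / 2` in the shift supplies `m ^ 2` on the left. -/
theorem coercivity_estimate {ε A m g r q G b : ℝ} (hε : 0 < ε) (hg : 0 ≤ g)
    (hq : |q| ≤ g * r) (hr : r ≤ A * m) (hG : g ^ 2 ≤ G) (hb : 0 ≤ b) :
    ε / 2 * (m ^ 2 + G) ≤ ε * G + q + b + (ε / 2 + A ^ 2 / (2 * ε)) * m ^ 2 := by
  have e1 : ε / 2 * g ^ 2 + A ^ 2 / (2 * ε) * m ^ 2 - g * (A * m)
      = (ε * g - A * m) ^ 2 / (2 * ε) := by field_simp; ring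
  have e2 : 0 ≤ (ε * g - A * m) ^ 2 / (2 * ε) := by positivity
  have e3 : g * r ≤ g * (A * m) := mul_le_mul_of_nonneg_left hr hg
  have e4 : ε / 2 * g ^ 2 ≤ ε / 2 * G := mul_le_mul_of_nonneg_left hG (by positivity)
  linarith [(abs_le.1 hq).1]

theorem norm_sq_le_sum {ι : Type*} [Fintype ι] {G : Type*} [NormedAddCommGroup G] (g : ι → G)
    (i : ι) : ‖g i‖ ^ 2 ≤ ∑ i, ‖g i‖ ^ 2 :=
  Finset.single_le_sum (f := fun i => ‖g i‖ ^ 2) (fun _ _ => sq_nonneg _) (Finset.mem_univ i)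

variable {val gr} (hn : ∀ e, ‖e‖ ^ 2 = ‖val e‖ ^ 2 + ∑ i, ‖gr i e‖ ^ 2)
include hn

theorem norm_grad_le (i : Fin (d + 1)) (e : E) : ‖gr i e‖ ≤ ‖e‖ := by
  refine le_of_sq_le_sq ?_ (norm_nonneg _)
  rw [hn]
  linarith [norm_sq_le_sum (fun i => gr i e) i, sq_nonneg ‖val e‖]

theorem formL_coercive (hε : 0 < ε) (e : E) :
    ε / 2 * ‖e‖ ^ 2 ≤ formL val gr hε e e +
      (ε / 2 + ‖toOmega d L ε‖ ^ 2 / (2 * ε)) * ‖val e‖ ^ 2 := by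
  have h0 : formL val gr hε e e = ε * (∑ i, ‖gr i e‖ ^ 2)
      + inner ℝ (gr (Fin.last d) e) (toOmega d L ε (val e)) + ‖toSurf d L hε (val e)‖ ^ 2 := by
    rw [formL_apply, real_inner_self_eq_norm_sq,
      Finset.sum_congr rfl fun i _ => real_inner_self_eq_norm_sq (gr i e)]
  rw [h0, hn]
  exact coercivity_estimate hε (norm_nonneg _) (abs_real_inner_le_norm _ _)
    ((toOmega d L ε).le_opNorm _) (norm_sq_le_sum (fun i => gr i e) (Fin.last d)) (sq_nonneg _)

/-- Diffusion and the `Γ₁` term are symmetric and cancel. Only advection remains, with a derivative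
on one factor alone. -/
theorem formL_skew (hε : 0 < ε) (e f : E) :
    |formL val gr hε e f - formL val gr hε f e| ≤
      ‖toOmega d L ε‖ * (‖e‖ * ‖val f‖ + ‖f‖ * ‖val e‖) := by
  have key : ∀ e f : E, |inner ℝ (gr (Fin.last d) e) (toOmega d L ε (val f))|
        ≤ ‖toOmega d L ε‖ * (‖e‖ * ‖val f‖) := fun e f => by
    refine (abs_real_inner_le_norm _ _).trans ?_
    calc _ ≤ ‖e‖ * (‖toOmega d L ε‖ * ‖val f‖) :=
          mul_le_mul (norm_grad_le hn _ e) ((toOmega d L ε).le_opNorm _) (norm_nonneg _)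
            (norm_nonneg _)
      _ = _ := by ring
  have e1 : formL val gr hε e f - formL val gr hε f e =
      inner ℝ (gr (Fin.last d) e) (toOmega d L ε (val f)) -
      inner ℝ (gr (Fin.last d) f) (toOmega d L ε (val e)) := by
    rw [formL_apply, formL_apply, real_inner_comm (toSurf d L hε (val e)),
      Finset.sum_congr rfl fun i _ => real_inner_comm (gr i f) (gr i e)]
    ring
  rw [e1, mul_add]
  exact (abs_sub _ _).trans (add_le_add (key e f) (key f e))

end Form

/-- The value part on a subspace of pairs. -/
noncomputable def valOn {d : ℕ} {L ε : ℝ} (V : Submodule ℝ (Pairs d L ε)) : V →L[ℝ] X d L ε :=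
  (valL d L ε).comp V.subtypeL

/-- The gradient part on a subspace of pairs. -/
noncomputable def gradOn {d : ℕ} {L ε : ℝ} (V : Submodule ℝ (Pairs d L ε)) (i : Fin (d + 1)) :
    V →L[ℝ] Lp ℝ 2 (volume.restrict (Omega d L) : Measure (Pt d)) :=
  (gradL d L ε i).comp V.subtypeL

/-- The operator `𝒜` is the operator of the form `a` on the Hilbert space `V = H¹(Ω)`. -/
theorem isA_iff_formOp {d : ℕ} {L ε : ℝ} (hε : 0 < ε) {V : Submodule ℝ (Pairs d L ε)}
    (hV : ∀ e : Pairs d L ε, e ∈ V ↔ IsH1 (valL d L ε e) (fun i => gradL d L ε i e))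
    (u w : X d L ε) :
    IsA u w ↔ FormOp (V := V) (valOn V)
      (formL (E := V) (valOn V) (gradOn V) hε) u w := by
  constructor
  · rintro ⟨p, hp, h⟩
    -- Elements of `V` carry their gradient, so uniqueness of weak gradients plays no role.
    refine ⟨⟨Pairs.mk u p, (hV _).2 hp⟩, rfl, fun φ => ?_⟩
    rw [formL_eq_form]
    exact h _ _ ((hV φ).1 φ.2)
  · rintro ⟨e, rfl, h⟩
    refine ⟨_, (hV e).1 e.2, fun v q hq => ?_⟩
    have := h ⟨Pairs.mk v q, (hV _).2 hq⟩
    rw [formL_eq_form] at this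
    exact this

end AdvDiff

/-- Backward uniqueness for the direct system and for the adjoint system, in `ℝⁿ`, `n = d + 1`. -/
theorem mainTheorem7 (d : ℕ) (L ε T : ℝ) (hL : 0 < L) (hε : 0 < ε) (hT : 0 < T) :
    (∀ (u₀ : AdvDiff.X d L ε) (u : ℝ → AdvDiff.X d L ε),
      AdvDiff.IsWeakSol T u₀ u → u T = 0 → u₀ = 0) ∧
    (∀ (φT : AdvDiff.X d L ε) (φ : ℝ → AdvDiff.X d L ε),
      AdvDiff.IsAdjointWeakSol T φT φ → φ 0 = 0 → φT = 0) := by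
  obtain ⟨V, hVc, hV⟩ := AdvDiff.exists_sobolev (d := d) (L := L) hε
  have : CompleteSpace V := hVc.completeSpace_coe
  have hA := AdvDiff.isA_iff_formOp hε hV
  have hn : ∀ e : V, ‖e‖ ^ 2 = ‖AdvDiff.valOn V e‖ ^ 2 +
      ∑ i, ‖AdvDiff.gradOn V i e‖ ^ 2 := fun e =>
    AdvDiff.norm_sq_pairs (e : AdvDiff.Pairs d L ε)
  have hc : 0 < ε / 2 := by positivity
  have hcoer := AdvDiff.formL_coercive (E := V) hn hε
  have hskew := AdvDiff.formL_skew (E := V) hn hε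
  refine ⟨fun u₀ u hu huT => ?_, fun φT φ hφ hφ0 => ?_⟩
  · exact backward_uniqueness hc hcoer hskew hT hu.1 hu.2.1
      (fun t ht => (hA _ _).1 (hu.2.2 t ht)) huT
  · have hmaps : MapsTo (fun t => T - t) (Icc 0 T) (Icc 0 T) := fun t ht =>
      ⟨by linarith [ht.2], by linarith [ht.1]⟩
    -- Flipping the form changes neither its diagonal nor the size of its skew part, so `hcoer`
    -- applies as it stands.
    refine backward_uniqueness (C := ‖AdvDiff.toOmega d L ε‖)
      (a := (AdvDiff.formL (E := V) (AdvDiff.valOn V)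
        (AdvDiff.gradOn V) hε).flip)
      (u := fun t => φ (T - t)) hc hcoer (fun u v => ?_) hT
      (hφ.1.comp (by fun_prop) hmaps) (by simpa using hφ.2.1) (fun t ht => ?_) (by simpa using hφ0)
    · exact (hskew v u).trans_eq (congrArg _ (add_comm _ _))
    · have h := hφ.2.2 (T - t) (hmaps ht)
      -- Time reversal turns the integral over `[0, t]` into the one over `[T - t, T]`.
      rw [intervalIntegral.integral_comp_sub_left (fun s => φ s) T, sub_zero]
      exact formOp_flip_of_adjoint hc hcoer fun v z hvz => h v z ((hA v z).2 hvz)
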